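/- For a number field $K$ with ring of integers $\mathcal{O}_K$ and a positive integer $q$, let $\Pi_q(K)$ be the product of all nonzero prime ideals of $\mathcal{O}_K$ of norm $q$ (with $\Pi_q(K)=\mathcal{O}_K$ if there are none), and let the Pólya group $Po(K)$ be the subgroup of the ideal class group of $K$ generated by the classes of all the ideals $\Pi_q(K)$. **Theorem.** Let $k\ge 1$ be an integer and let $M$ be a positive real number. (i) There exists an integer $d$ such that, for every $i=1,\dots,k$, $d+i>0$, the field $K_i:=\mathbb{Q}(\sqrt{d+i})$ is a (real) quadratic field, and $|Po(K_i)|>M$. (ii) There exists an integer $d$ such that, for every $i=1,\dots,k$, $d+i<0$, the field $K_i:=\mathbb{Q}(\sqrt{d+i})$ is an (imaginary) quadratic field, and $|Po(K_i)|>M$. -/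

import Mathlib

open scoped NumberField nonZeroDivisors

noncomputable section

/-- The set of nonzero prime ideals of `𝓞 K` whose absolute norm is `q`. -/
def primesOfNorm (K : Type*) [Field K] [NumberField K] (q : ℕ) :
    Set (IsDedekindDomain.HeightOneSpectrum (𝓞 K)) :=
  {p | Ideal.absNorm p.asIdeal = q}

theorem primesOfNorm_finite (K : Type*) [Field K] [NumberField K] (q : ℕ) :
    (primesOfNorm K q).Finite :=
  Set.Finite.of_finite_image
    ((Ideal.finite_setOfPred_absNorm_le (S := 𝓞 K) q).subset (by
      rintro _ ⟨p, hp, rfl⟩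
      exact le_of_eq hp))
    (fun _ _ _ _ h => IsDedekindDomain.HeightOneSpectrum.ext h)

/-- The ideal `Π_q(K)`: the product of all nonzero prime ideals of norm `q`. It is the unit ideal
(an empty product) when there are none. -/
def ostrowskiIdeal (K : Type*) [Field K] [NumberField K] (q : ℕ) : Ideal (𝓞 K) :=
  ∏ p ∈ (primesOfNorm_finite K q).toFinset, p.asIdeal

theorem ostrowskiIdeal_mem (K : Type*) [Field K] [NumberField K] (q : ℕ) :
    ostrowskiIdeal K q ∈ (Ideal (𝓞 K))⁰ :=
  mem_nonZeroDivisors_of_ne_zero (Finset.prod_ne_zero_iff.2 fun p _ => p.ne_bot)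

/-- The Pólya group of a number field `K`: the subgroup of the class group generated by the
classes of all the ideals `Π_q(K)`. -/
def polyaGroup (K : Type*) [Field K] [NumberField K] : Subgroup (ClassGroup (𝓞 K)) :=
  Subgroup.closure
    (Set.range fun q : ℕ => ClassGroup.mk0 ⟨ostrowskiIdeal K q, ostrowskiIdeal_mem K q⟩)

/-- The field `ℚ(√m)`, as a subfield of `ℂ`. -/
def quadField (m : ℤ) : IntermediateField ℚ ℂ :=
  IntermediateField.adjoin ℚ {Complex.sqrt (m : ℂ)}

instance quadField_numberField (m : ℤ) : NumberField (quadField m) where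
  to_charZero := inferInstance
  to_finiteDimensional := by
    refine IntermediateField.adjoin.finiteDimensional ?_
    refine IsIntegral.of_pow (n := 2) (by norm_num) ?_
    have h : Complex.sqrt (m : ℂ) ^ 2 = algebraMap ℚ ℂ (m : ℚ) := by
      have h2 : Complex.sqrt (m : ℂ) ^ 2 = (m : ℂ) := by
        simp [Complex.sqrt]
      simpa using h2
    rw [h]
    exact isIntegral_algebraMap

end

open scoped NumberField nonZeroDivisors

/-! This is genus theory. A prime `p` dividing `m` exactly once ramifies in `ℚ(√m)`, so `Π_p` has
norm `p` and its square is `(p)`: its class lies in the Pólya group and is killed by 2. A relation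
among such classes yields an integer `x` whose norm is, up to sign, a product of these primes. But
`4 * N(x)` is a square modulo every `ℓ` dividing `m` exactly once (`exists_dvd_sq_sub_four_norm`),
and `ℓ ≡ 1 mod 4` makes the sign harmless. If the symbols `(p i / ℓ j)` are `-1` exactly on the
diagonal, no nontrivial relation survives, and `n` pairs give `2 ^ n` classes.

Dirichlet's theorem supplies such primes (`exists_primes_jacobiSym_eq`). A separate block of them is
given to each `d + i` by the Chinese remainder theorem, and `d` is then shifted to fix the sign. -/

/-- If `c` is rational, `m * c ^ 2` is an integer and the prime `ℓ` divides `m` exactly once, then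
`ℓ` divides `m * c ^ 2`. -/
theorem Prime.dvd_of_eq_mul_rat_sq {ℓ m D : ℤ} (hℓ : Prime ℓ) (h1 : ℓ ∣ m) (h2 : ¬ ℓ ^ 2 ∣ m)
    {c : ℚ} (h : (D : ℚ) = m * c ^ 2) : ℓ ∣ D := by
  have hden : (c.den : ℚ) ≠ 0 := by exact_mod_cast c.den_ne_zero
  have e : D * (c.den : ℤ) ^ 2 = m * c.num ^ 2 := by
    have : (D : ℚ) * (c.den : ℚ) ^ 2 = m * (c.num : ℚ) ^ 2 := by
      rw [h, mul_assoc, ← mul_pow, Rat.mul_den_eq_num]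
    exact_mod_cast this
  by_contra hD
  have hd : ℓ ∣ (c.den : ℤ) := by
    have : ℓ ∣ D * (c.den : ℤ) ^ 2 := e ▸ h1.mul_right _
    exact hℓ.dvd_of_dvd_pow ((hℓ.dvd_or_dvd this).resolve_left hD)
  have hn : ℓ ∣ c.num := by
    obtain ⟨m', rfl⟩ := h1
    have h3 : ℓ * ℓ ∣ ℓ * (m' * c.num ^ 2) := by
      rw [← mul_assoc, ← e, ← sq]
      exact (pow_dvd_pow_of_dvd hd 2).mul_left D
    have h4 := (mul_dvd_mul_iff_left hℓ.ne_zero).1 h3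
    refine hℓ.dvd_of_dvd_pow ((hℓ.dvd_or_dvd h4).resolve_left fun h5 => h2 ?_)
    rw [sq]
    exact mul_dvd_mul_left ℓ h5
  have hc : IsCoprime c.num (c.den : ℤ) := Int.isCoprime_iff_gcd_eq_one.2 c.reduced
  exact hℓ.not_isUnit (hc.isUnit_of_dvd' hn hd)

/-- An integer that some prime divides exactly once is not the square of a rational. -/
theorem Prime.ne_rat_sq {ℓ m : ℤ} (hℓ : Prime ℓ) (h1 : ℓ ∣ m) (h2 : ¬ ℓ ^ 2 ∣ m) (r : ℚ) :
    r ^ 2 ≠ m := by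
  intro h
  have hm : (m : ℚ) ≠ 0 := by
    rintro h0
    exact h2 (by simp [Int.cast_eq_zero.1 h0])
  have hr : r ≠ 0 := by rintro rfl; exact hm (by simpa using h.symm)
  refine hℓ.not_isUnit (isUnit_of_dvd_one (hℓ.dvd_of_eq_mul_rat_sq h1 h2 (D := 1) (c := r⁻¹) ?_))
  rw [← h]
  field_simp
  simp

/-! ### Norm and trace in a quadratic extension -/

section NormTrace

variable {F K : Type*} [Field F] [Field K] [Algebra F K]

theorem linearIndependent_one_sqrt {s : K} {m : F} (hs : s ^ 2 = algebraMap F K m)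
    (hm : ∀ r : F, r ^ 2 ≠ m) : LinearIndependent F ![1, s] := by
  rw [LinearIndependent.pair_iff]
  intro a b h
  have hb : b = 0 := by
    by_contra hb
    refine hm (-a / b) ((algebraMap F K).injective ?_)
    have hb' : algebraMap F K b ≠ 0 := by simpa using hb
    have hs' : s = algebraMap F K (-a / b) := by
      rw [map_div₀, eq_div_iff hb', map_neg]
      rw [Algebra.smul_def, Algebra.smul_def] at h
      linear_combination h
    rw [map_pow, ← hs', hs]
  subst hb
  simpa using h

/-- In a quadratic extension generated by a square root of `m`, the discriminant of the
characteristic polynomial of an element is `m` times a square. -/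
theorem exists_trace_sq_sub_four_norm {s : K} {m : F} (hs : s ^ 2 = algebraMap F K m)
    (hm : ∀ r : F, r ^ 2 ≠ m) (hK : Module.finrank F K = 2) (x : K) :
    ∃ c : F, Algebra.trace F K x ^ 2 - 4 * Algebra.norm F x = m * c ^ 2 := by
  let b := basisOfLinearIndependentOfCardEqFinrank (linearIndependent_one_sqrt hs hm) (by simp [hK])
  have b0 : b 0 = 1 := by simp [b]
  have b1 : b 1 = s := by simp [b]
  obtain ⟨u, v, rfl⟩ : ∃ u v : F, x = u • b 0 + v • b 1 :=
    ⟨b.repr x 0, b.repr x 1, by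
      rw [← Fin.sum_univ_two fun i => b.repr x i • b i, b.sum_repr]⟩
  have h0 : (u • b 0 + v • b 1) * b 0 = u • b 0 + v • b 1 := by simp [b0]
  have h1 : (u • b 0 + v • b 1) * b 1 = (v * m) • b 0 + u • b 1 := by
    rw [b0, b1]
    simp only [Algebra.smul_def, map_mul, ← hs]
    ring
  have hM : Algebra.leftMulMatrix b (u • b 0 + v • b 1) = !![u, v * m; v, u] := by
    ext i j
    rw [Algebra.leftMulMatrix_eq_repr_mul]
    fin_cases j
    · change b.repr ((u • b 0 + v • b 1) * b 0) i = _
      rw [h0]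
      fin_cases i <;> simp
    · change b.repr ((u • b 0 + v • b 1) * b 1) i = _
      rw [h1]
      fin_cases i <;> simp
  -- The trace is `2u` and the norm is `u² - m v²`.
  refine ⟨2 * v, ?_⟩
  rw [Algebra.norm_eq_matrix_det b, Algebra.trace_eq_matrix_trace b, hM, Matrix.det_fin_two,
    Matrix.trace_fin_two]
  simp
  ring

end NormTrace

/-! ### Ramified primes and norms in `ℚ(√m)` -/

section QuadraticField

variable {K : Type*} [Field K] [NumberField K]

/-- Norms of integers of `ℚ(√m)` are squares modulo `ℓ`, up to a factor `4`, for the primes `ℓ` that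
divide `m` exactly once. -/
theorem exists_dvd_sq_sub_four_norm {s : 𝓞 K} {m ℓ : ℤ} (hs : s ^ 2 = m)
    (hK : Module.finrank ℚ K = 2) (hℓ : Prime ℓ) (h1 : ℓ ∣ m) (h2 : ¬ ℓ ^ 2 ∣ m) (x : 𝓞 K) :
    ∃ t : ℤ, ℓ ∣ t ^ 2 - 4 * Algebra.norm ℤ x := by
  have hs' : (s : K) ^ 2 = algebraMap ℚ K (m : ℚ) := by
    simpa using congrArg (algebraMap (𝓞 K) K) hs
  obtain ⟨c, hc⟩ := exists_trace_sq_sub_four_norm hs' (hℓ.ne_rat_sq h1 h2) hK (x : K)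
  refine ⟨Algebra.trace ℤ (𝓞 K) x, hℓ.dvd_of_eq_mul_rat_sq h1 h2 (c := c) ?_⟩
  rw [← hc, ← Algebra.coe_norm_int, ← Algebra.coe_trace_int]
  push_cast
  rfl

/-- A prime dividing `m` exactly once ramifies in `ℚ(√m)`. -/
theorem span_pair_sq {R : Type*} [CommRing R] {s : R} {m p : ℤ} (hs : s ^ 2 = m) (hp : Prime p)
    (h1 : p ∣ m) (h2 : ¬ p ^ 2 ∣ m) : Ideal.span {(p : R), s} ^ 2 = Ideal.span {(p : R)} := by
  obtain ⟨n, rfl⟩ := h1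
  have hn : IsCoprime p n :=
    (Prime.coprime_iff_not_dvd hp).2 fun h => h2 (by rw [sq]; exact mul_dvd_mul_left p h)
  obtain ⟨u, v, huv⟩ := hn
  have huv' : (u : R) * p + v * n = 1 := by exact_mod_cast congrArg (Int.cast : ℤ → R) huv
  push_cast at hs
  rw [sq, Ideal.span_pair_mul_span_pair]
  apply le_antisymm
  · rw [Ideal.span_le]
    rintro y (rfl | rfl | rfl | rfl)
    · exact Ideal.mem_span_singleton.2 (dvd_mul_right _ _)
    · exact Ideal.mem_span_singleton.2 (dvd_mul_right _ _)
    · exact Ideal.mem_span_singleton.2 (dvd_mul_left _ _)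
    · exact Ideal.mem_span_singleton.2 ⟨n, by rw [← sq, hs]⟩
  · rw [Ideal.span_singleton_le_iff_mem]
    -- Multiply `u p + v n = 1` by `p` and use `s² = p n`.
    have : (p : R) = u * (p * p) + v * (s * s) := by
      linear_combination (-(p : R)) * huv' - (v : R) * hs
    have hpp : (p : R) * p ∈ Ideal.span {(p : R) * p, (p : R) * s, s * (p : R), s * s} :=
      Ideal.subset_span (by simp)
    have hss : s * s ∈ Ideal.span {(p : R) * p, (p : R) * s, s * (p : R), s * s} :=
      Ideal.subset_span (by simp)
    have hadd := Ideal.add_mem _ (Ideal.mul_mem_left _ (u : R) hpp)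
      (Ideal.mul_mem_left _ (v : R) hss)
    rwa [← this] at hadd

theorem absNorm_ostrowskiIdeal_and_sq {s : 𝓞 K} {m : ℤ} {p : ℕ} (hs : s ^ 2 = m)
    (hK : Module.finrank ℚ K = 2) (hp : p.Prime) (h1 : (p : ℤ) ∣ m) (h2 : ¬ (p : ℤ) ^ 2 ∣ m) :
    Ideal.absNorm (ostrowskiIdeal K p) = p ∧
      ostrowskiIdeal K p ^ 2 = Ideal.span {(p : 𝓞 K)} := by
  set I : Ideal (𝓞 K) := Ideal.span {((p : ℤ) : 𝓞 K), s}
  have hI : I ^ 2 = Ideal.span {(p : 𝓞 K)} := by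
    rw [span_pair_sq hs (Nat.prime_iff_prime_int.1 hp) h1 h2, Int.cast_natCast]
  have hN : Ideal.absNorm I = p := by
    have h := congrArg Ideal.absNorm hI
    have hr : Module.finrank ℤ (𝓞 K) = 2 := by rw [NumberField.RingOfIntegers.rank, hK]
    rw [map_pow, Ideal.absNorm_span_natCast, hr] at h
    exact Nat.pow_left_injective (by norm_num : 2 ≠ 0) h
  have hI0 : I ≠ ⊥ := by
    intro h0
    rw [h0, Ideal.absNorm_bot] at hN
    exact hp.ne_zero hN.symm
  have hprime : I.IsPrime := Ideal.isPrime_of_irreducible_absNorm (by rw [hN]; exact hp)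
  let P : IsDedekindDomain.HeightOneSpectrum (𝓞 K) := ⟨I, hprime, hI0⟩
  have huniq : primesOfNorm K p = {P} := by
    refine Set.eq_singleton_iff_unique_mem.2 ⟨hN, fun Q hQ => ?_⟩
    -- A prime of norm `p` contains `p`, hence `I ^ 2`, hence `I`.
    have hle : I ≤ Q.asIdeal := by
      have hmem : (p : 𝓞 K) ∈ Q.asIdeal := by
        have := Ideal.absNorm_mem Q.asIdeal
        rwa [show Ideal.absNorm Q.asIdeal = p from hQ] at this
      refine Q.isPrime.le_of_pow_le (n := 2) ?_
      rw [hI, Ideal.span_singleton_le_iff_mem]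
      exact hmem
    have : I.IsMaximal := hprime.isMaximal hI0
    exact IsDedekindDomain.HeightOneSpectrum.ext (this.eq_of_le Q.isPrime.ne_top hle).symm
  have hO : ostrowskiIdeal K p = I := by
    have : (primesOfNorm_finite K p).toFinset = {P} := by
      ext Q
      simp [huniq]
    rw [ostrowskiIdeal, this, Finset.prod_singleton]
  rw [hO]
  exact ⟨hN, hI⟩

end QuadraticField

/-! ### Independence of the ramified classes -/

theorem jacobiSym_prod_left {ι : Type*} (S : Finset ι) (a : ι → ℤ) (b : ℕ) :
    jacobiSym (∏ i ∈ S, a i) b = ∏ i ∈ S, jacobiSym (a i) b :=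
  map_prod (⟨⟨fun a => jacobiSym a b, jacobiSym.one_left b⟩,
    fun x y => jacobiSym.mul_left x y b⟩ : ℤ →* ℤ) a S

/-- For a prime `ℓ ≡ 1 mod 4`, if `4n` is a square modulo `ℓ` then `|n|` is not a nonresidue. -/
theorem jacobiSym_natAbs_ne_neg_one {ℓ : ℕ} (h4 : ℓ % 4 = 1) {t n : ℤ}
    (h : (ℓ : ℤ) ∣ t ^ 2 - 4 * n) : jacobiSym n.natAbs ℓ ≠ -1 := by
  have hodd : Odd ℓ := Nat.odd_iff.2 (by omega)
  have h2 : jacobiSym 2 ℓ ^ 2 = 1 := by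
    refine jacobiSym.sq_one ?_
    have := (Nat.coprime_two_left (n := ℓ)).2 hodd
    exact_mod_cast this
  have hneg : jacobiSym (-1) ℓ = 1 := by
    rw [jacobiSym.at_neg_one hodd, ZMod.χ₄_nat_one_mod_four h4]
  have habs : jacobiSym n.natAbs ℓ = jacobiSym n ℓ := by
    rcases Int.natAbs_eq n with h' | h'
    · rw [← h']
    · conv_rhs => rw [h', neg_eq_neg_one_mul, jacobiSym.mul_left, hneg, one_mul]
  have h3 : jacobiSym (t ^ 2) ℓ = jacobiSym (2 ^ 2 * n) ℓ :=
    jacobiSym.mod_left' (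
      Int.emod_eq_emod_iff_emod_sub_eq_zero.2 (Int.emod_eq_zero_of_dvd
        (by convert h using 1; ring)))
  rw [jacobiSym.pow_left, jacobiSym.mul_left, jacobiSym.pow_left, h2, one_mul] at h3
  rw [habs, ← h3]
  intro h5
  linarith [sq_nonneg (jacobiSym t ℓ)]

theorem mk0_ostrowskiIdeal_mem_polyaGroup (K : Type*) [Field K] [NumberField K] (q : ℕ) :
    ClassGroup.mk0 ⟨ostrowskiIdeal K q, ostrowskiIdeal_mem K q⟩ ∈ polyaGroup K :=
  Subgroup.subset_closure (Set.mem_range_self q)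

theorem two_pow_card_le_card_polyaGroup {K : Type*} [Field K] [NumberField K] {s : 𝓞 K} {m : ℤ}
    (hs : s ^ 2 = m) (hK : Module.finrank ℚ K = 2) {ι : Type*} [Fintype ι] [DecidableEq ι]
    {p ℓ : ι → ℕ} (hp : ∀ i, (p i).Prime) (hℓ : ∀ i, (ℓ i).Prime) (h4 : ∀ i, ℓ i % 4 = 1)
    (hpm : ∀ i, (p i : ℤ) ∣ m ∧ ¬ (p i : ℤ) ^ 2 ∣ m) (hℓm : ∀ i, (ℓ i : ℤ) ∣ m ∧ ¬ (ℓ i : ℤ) ^ 2 ∣ m)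
    (hχ : ∀ i j, jacobiSym (p i) (ℓ j) = if i = j then -1 else 1) :
    2 ^ Fintype.card ι ≤ Nat.card (polyaGroup K) := by
  let I : ι → (Ideal (𝓞 K))⁰ := fun i => ⟨ostrowskiIdeal K (p i), ostrowskiIdeal_mem K (p i)⟩
  have hI i : Ideal.absNorm (I i : Ideal (𝓞 K)) = p i :=
    (absNorm_ostrowskiIdeal_and_sq hs hK (hp i) (hpm i).1 (hpm i).2).1
  have hsq i : ClassGroup.mk0 (I i) ^ 2 = 1 := by
    rw [← map_pow, ClassGroup.mk0_eq_one_iff]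
    have := (absNorm_ostrowskiIdeal_and_sq hs hK (hp i) (hpm i).1 (hpm i).2).2
    exact ⟨(p i : 𝓞 K), this⟩
  let f : Finset ι → polyaGroup K := fun S =>
    ⟨∏ i ∈ S, ClassGroup.mk0 (I i),
      Subgroup.prod_mem _ fun i _ => mk0_ostrowskiIdeal_mem_polyaGroup K (p i)⟩
  have hf : Function.Injective f := by
    intro S T hST
    by_contra hne
    obtain ⟨r, hr⟩ : ∃ r, ¬ (r ∈ S ↔ r ∈ T) := by
      by_contra! h
      exact hne (Finset.ext h)
    -- The classes are their own inverses, so a product can replace the quotient and the ideal stays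
    -- integral.
    have hone : ClassGroup.mk0 ((∏ i ∈ S, I i) * ∏ i ∈ T, I i) = 1 := by
      have hST' : ∏ i ∈ S, ClassGroup.mk0 (I i) = ∏ i ∈ T, ClassGroup.mk0 (I i) :=
        congrArg Subtype.val hST
      rw [map_mul, map_prod, map_prod, hST', ← sq, ← Finset.prod_pow]
      exact Finset.prod_eq_one fun i _ => hsq i
    have hprinc (J : (Ideal (𝓞 K))⁰) (hJ : ClassGroup.mk0 J = 1) :
        ∃ x : 𝓞 K, (J : Ideal (𝓞 K)) = Ideal.span {x} :=
      ((ClassGroup.mk0_eq_one_iff J.2).1 hJ).principal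
    obtain ⟨x, hx⟩ := hprinc _ hone
    obtain ⟨t, ht⟩ := exists_dvd_sq_sub_four_norm hs hK (Nat.prime_iff_prime_int.1 (hℓ r))
      (hℓm r).1 (hℓm r).2 x
    have hN : (Algebra.norm ℤ x).natAbs = (∏ i ∈ S, p i) * ∏ i ∈ T, p i := by
      rw [← Ideal.absNorm_span_singleton, ← hx, Submonoid.coe_mul, map_mul,
        Submonoid.coe_finsetProd, Submonoid.coe_finsetProd, map_prod, map_prod]
      simp only [hI]
    refine jacobiSym_natAbs_ne_neg_one (h4 r) ht ?_
    rw [hN]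
    push_cast
    rw [jacobiSym.mul_left, jacobiSym_prod_left, jacobiSym_prod_left]
    simp only [hχ, Finset.prod_ite_eq']
    -- As `r` lies in exactly one of `S` and `T`, the symbol is `-1`.
    by_cases hS : r ∈ S <;> by_cases hT : r ∈ T <;> simp_all
  have := Nat.card_le_card_of_injective f hf
  simpa using this

/-! ### Choice of the primes and of `d` -/

/-- There are primes `ℓ i ≡ 1 mod 4` and `p i`, all distinct, such that `p i` is a quadratic
nonresidue modulo `ℓ i` and a residue modulo the other `ℓ j`. -/
theorem exists_primes_jacobiSym_eq (ι : Type*) [Fintype ι] [DecidableEq ι] :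
    ∃ p ℓ : ι → ℕ, (∀ i, (p i).Prime) ∧ (∀ i, (ℓ i).Prime) ∧ (∀ i, ℓ i % 4 = 1) ∧
      (∀ i j, jacobiSym (p i) (ℓ j) = if i = j then -1 else 1) ∧
      Function.Injective (Sum.elim p ℓ) := by
  have hinf : {q : ℕ | q.Prime ∧ q ≡ 1 [MOD 4]}.Infinite :=
    Nat.infinite_setOfPred_prime_modEq_one (by norm_num)
  let e : ι → ℕ := fun i => hinf.natEmbedding _ (Fintype.equivFin ι i)
  have he : Function.Injective e := fun i j h => by
    simpa [e, Fin.val_inj, Subtype.val_inj] using h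
  have heP i : (e i).Prime := (hinf.natEmbedding _ (Fintype.equivFin ι i)).2.1
  have he4 i : e i % 4 = 1 := (hinf.natEmbedding _ (Fintype.equivFin ι i)).2.2
  have hcop : Pairwise (Function.onFun Nat.Coprime e) := fun i j hij =>
    (Nat.coprime_primes (heP i) (heP j)).2 (he.ne hij)
  have hnr i : ∃ a : ℕ, jacobiSym a (e i) = -1 := by
    have := Fact.mk (heP i)
    obtain ⟨a, ha⟩ := quadraticChar_exists_neg_one (F := ZMod (e i)) (by
      rw [ZMod.ringChar_zmod_n]
      have := he4 i
      omega)
    refine ⟨a.val, ?_⟩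
    rw [← jacobiSym.legendreSym.to_jacobiSym, legendreSym]
    simpa using ha
  choose a ha using hnr
  have hp i : ∃ p : ℕ, p.Prime ∧ ∀ j, jacobiSym p (e j) = if i = j then -1 else 1 := by
    obtain ⟨c, hc⟩ := Nat.chineseRemainderOfFinset (fun j => if i = j then a i else 1) e
      Finset.univ (fun j _ => (heP j).ne_zero) (fun j _ k _ h => hcop h)
    have hcj (n : ℕ) (hn : n ≡ c [MOD ∏ j, e j]) (j : ι) :
        jacobiSym n (e j) = if i = j then -1 else 1 := by
      have h1 : n ≡ (if i = j then a i else 1) [MOD e j] :=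
        (hn.of_dvd (Finset.dvd_prod_of_mem e (Finset.mem_univ j))).trans (hc j (Finset.mem_univ j))
      rw [jacobiSym.mod_left' (by exact_mod_cast h1 :
        (n : ℤ) % (e j : ℤ) = ((if i = j then a i else 1 : ℕ) : ℤ) % (e j : ℤ))]
      split_ifs with h
      · subst h; exact ha i
      · simp
    -- The prescribed symbols are nonzero, so Dirichlet's theorem applies to the class of `c`.
    have hc' : c.Coprime (∏ j, e j) := by
      refine Nat.Coprime.prod_right fun j _ => ?_
      have h := hcj c rfl j
      have h0 : jacobiSym c (e j) ≠ 0 := by rw [h]; split_ifs <;> simp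
      by_contra hg
      exact h0 (jacobiSym.eq_zero_iff.2 ⟨(heP j).ne_zero, by simpa using hg⟩)
    have : NeZero (∏ j, e j) := ⟨Finset.prod_ne_zero_iff.2 fun j _ => (heP j).ne_zero⟩
    obtain ⟨p, -, hpp, hpc⟩ :=
      Nat.forall_exists_prime_gt_and_eq_mod ((ZMod.isUnit_iff_coprime c _).2 hc') 0
    exact ⟨p, hpp, hcj p ((ZMod.natCast_eq_natCast_iff _ _ _).1 hpc)⟩
  choose p hpP hpχ using hp
  refine ⟨p, e, hpP, heP, he4, hpχ, Function.Injective.sumElim ?_ he ?_⟩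
  · intro i j hij
    by_contra h
    have h1 := hpχ i j
    have h2 := hpχ j j
    rw [hij] at h1
    rw [h1] at h2
    simp [h] at h2
  · intro i j hij
    have h := hpχ i j
    rw [hij, jacobiSym.eq_zero_iff.2 ⟨(heP j).ne_zero, ?_⟩] at h
    · split_ifs at h
      exact zero_ne_one h
    · simpa using (heP j).ne_one

theorem exists_int_forall_dvd_sub {κ : Type*} [Finite κ] {q : κ → ℕ} (hq : ∀ j, (q j).Prime)
    (hinj : Function.Injective q) (a : κ → ℤ) :
    ∃ d : ℤ, ∀ j, (q j : ℤ) ∣ d + a j ∧ ¬ (q j : ℤ) ^ 2 ∣ d + a j := by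
  -- Solving `d + a j ≡ q j` modulo `(q j)²` forces divisibility exactly once.
  obtain ⟨d, hd⟩ := Ideal.exists_forall_sub_mem_ideal
    (I := fun j => Ideal.span {(q j : ℤ) ^ 2}) (fun i j hij => by
      rw [Function.onFun, Ideal.isCoprime_span_singleton_iff]
      exact (Nat.isCoprime_iff_coprime.2
        ((Nat.coprime_primes (hq i) (hq j)).2 (hinj.ne hij))).pow) (fun j => q j - a j)
  refine ⟨d, fun j => ?_⟩
  have h : (q j : ℤ) ^ 2 ∣ d + a j - q j := by
    have := Ideal.mem_span_singleton.1 (hd j)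
    rwa [show d - (q j - a j) = d + a j - q j by ring] at this
  constructor
  · exact (dvd_sub_self_right.1 ((dvd_pow_self _ two_ne_zero).trans h))
  · intro h'
    have h1 := (dvd_sub_right h').1 h
    have hP := Nat.prime_iff_prime_int.1 (hq j)
    rw [sq] at h1
    exact hP.not_isUnit (isUnit_of_dvd_one
      ((mul_dvd_mul_iff_left hP.ne_zero).1 (by rwa [mul_one])))

/-! ### The fields `quadField m` and the conclusion -/

theorem quadField_finrank {m : ℤ} (hm : ∀ r : ℚ, r ^ 2 ≠ m) :
    Module.finrank ℚ (quadField m) = 2 := by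
  have hs : Complex.sqrt (m : ℂ) ^ 2 = algebraMap ℚ ℂ (m : ℚ) := by simp [Complex.sqrt]
  have hirr : Irreducible (Polynomial.X ^ 2 - Polynomial.C (m : ℚ)) :=
    X_pow_sub_C_irreducible_of_prime Nat.prime_two hm
  have hmin : minpoly ℚ (Complex.sqrt (m : ℂ)) = Polynomial.X ^ 2 - Polynomial.C (m : ℚ) :=
    (minpoly.eq_of_irreducible_of_monic hirr (by simp [hs])
      (Polynomial.monic_X_pow_sub_C _ two_ne_zero)).symm
  have hint : IsIntegral ℚ (Complex.sqrt (m : ℂ)) :=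
    IsIntegral.of_pow two_pos (hs ▸ isIntegral_algebraMap)
  rw [quadField, IntermediateField.adjoin.finrank hint, hmin, Polynomial.natDegree_X_pow_sub_C]

theorem exists_integer_sq_eq (m : ℤ) : ∃ s : 𝓞 (quadField m), s ^ 2 = m := by
  have hs : Complex.sqrt (m : ℂ) ^ 2 = (m : ℂ) := by simp [Complex.sqrt]
  let x : quadField m := ⟨Complex.sqrt (m : ℂ), IntermediateField.mem_adjoin_simple_self ℚ _⟩
  have hx : x ^ 2 = (m : quadField m) := Subtype.ext (by simpa using hs)
  refine ⟨⟨x, IsIntegral.of_pow two_pos ?_⟩, ?_⟩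
  · rw [hx]
    exact isIntegral_algebraMap (x := m)
  · refine NumberField.RingOfIntegers.ext ?_
    exact hx

theorem theorem5p5 (k : ℕ) (hk : 1 ≤ k) (M : ℝ) (hM : 0 < M) :
    (∃ d : ℤ, ∀ i ∈ Finset.Icc 1 k,
      0 < d + (i : ℤ) ∧
      Algebra.IsQuadraticExtension ℚ (quadField (d + (i : ℤ))) ∧
      M < (Nat.card (polyaGroup (quadField (d + (i : ℤ)))) : ℝ)) ∧
    (∃ d : ℤ, ∀ i ∈ Finset.Icc 1 k,
      d + (i : ℤ) < 0 ∧
      Algebra.IsQuadraticExtension ℚ (quadField (d + (i : ℤ))) ∧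
      M < (Nat.card (polyaGroup (quadField (d + (i : ℤ)))) : ℝ)) := by
  obtain ⟨t, ht⟩ := pow_unbounded_of_one_lt M (one_lt_two (α := ℝ))
  -- With `t + 1` in place of `t`, each block contains a prime, which shows that `d + i` is not a
  -- square.
  let ι := Finset.Icc 1 k × Fin (t + 1)
  obtain ⟨p, ℓ, hp, hℓ, h4, hχ, hinj⟩ := exists_primes_jacobiSym_eq ι
  have hprime : ∀ j, (Sum.elim p ℓ j).Prime := Sum.rec hp hℓ
  obtain ⟨d, hd⟩ := exists_int_forall_dvd_sub hprime hinj
    (Sum.elim (fun j => ((j.1 : ℕ) : ℤ)) fun j => ((j.1 : ℕ) : ℤ))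
  -- Shifting `d` by multiples of `N` preserves exact divisibility by all the primes.
  let N : ℤ := ∏ j, ((Sum.elim p ℓ j : ℕ) : ℤ) ^ 2
  have hN : 0 < N := Finset.prod_pos fun j _ => pow_pos (by exact_mod_cast (hprime j).pos) 2
  have key (c : ℤ) (i : ℕ) (hi : i ∈ Finset.Icc 1 k) :
      Algebra.IsQuadraticExtension ℚ (quadField (d + N * c + (i : ℤ))) ∧
      M < (Nat.card (polyaGroup (quadField (d + N * c + (i : ℤ)))) : ℝ) := by
    have hm (j : ι ⊕ ι) (a : ℤ) (h : ((Sum.elim p ℓ j : ℕ) : ℤ) ∣ d + a ∧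
        ¬ ((Sum.elim p ℓ j : ℕ) : ℤ) ^ 2 ∣ d + a) :
        ((Sum.elim p ℓ j : ℕ) : ℤ) ∣ d + N * c + a ∧
        ¬ ((Sum.elim p ℓ j : ℕ) : ℤ) ^ 2 ∣ d + N * c + a := by
      have h2 : ((Sum.elim p ℓ j : ℕ) : ℤ) ^ 2 ∣ N * c :=
        (Finset.dvd_prod_of_mem (fun j => ((Sum.elim p ℓ j : ℕ) : ℤ) ^ 2)
          (Finset.mem_univ j)).mul_right c
      rw [add_right_comm]
      exact ⟨dvd_add h.1 ((dvd_pow_self _ two_ne_zero).trans h2),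
        fun h' => h.2 ((dvd_add_left h2).1 h')⟩
    have hpm (r : Fin (t + 1)) := hm (.inl (⟨i, hi⟩, r)) i (hd (.inl (⟨i, hi⟩, r)))
    have hℓm (r : Fin (t + 1)) := hm (.inr (⟨i, hi⟩, r)) i (hd (.inr (⟨i, hi⟩, r)))
    have hrank : Module.finrank ℚ (quadField (d + N * c + (i : ℤ))) = 2 :=
      quadField_finrank ((Nat.prime_iff_prime_int.1 (hp (⟨i, hi⟩, 0))).ne_rat_sq
        (hpm 0).1 (hpm 0).2)
    refine ⟨⟨hrank⟩, ?_⟩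
    obtain ⟨s, hs⟩ := exists_integer_sq_eq (d + N * c + (i : ℤ))
    have hcard := two_pow_card_le_card_polyaGroup hs hrank
      (p := fun r => p (⟨i, hi⟩, r)) (ℓ := fun r => ℓ (⟨i, hi⟩, r)) (fun r => hp _) (fun r => hℓ _)
      (fun r => h4 _) hpm hℓm (fun r r' => by
        rw [hχ]
        exact if_congr ⟨congrArg Prod.snd, congrArg _⟩ rfl rfl)
    rw [Fintype.card_fin] at hcard
    calc M < 2 ^ t := ht
      _ ≤ 2 ^ (t + 1) := pow_le_pow_right₀ one_le_two (Nat.le_succ t)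
      _ ≤ _ := by exact_mod_cast hcard
  -- Since `N ≥ 1`, these shifts outweigh `d`, and in the negative case also `i ≤ k`.
  refine ⟨⟨d + N * |d|, fun i hi => ⟨?_, key _ i hi⟩⟩,
    ⟨d + N * -(|d| + k + 1), fun i hi => ⟨?_, key _ i hi⟩⟩⟩
  · have h1 : (1 : ℤ) ≤ i := by exact_mod_cast (Finset.mem_Icc.1 hi).1
    nlinarith [neg_abs_le d, abs_nonneg d]
  · have h1 : (i : ℤ) ≤ k := by exact_mod_cast (Finset.mem_Icc.1 hi).2
    nlinarith [le_abs_self d, abs_nonneg d]
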